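/- Let $a>b>0$ be real numbers and put $p=\sqrt{a^2+b^2}$. Let $V^9=\mathbb{R}^9$ with coordinates $(\ell,m,h,u_1,Q_1,P_1,u_2,Q_2,P_2)$, and write $h_*=-\tfrac12(h+p^2m)$, $$f_1(u)=h_*u^2+a\ell u-a^2m,\qquad f_2(u)=b^2m\,u^2-b\ell u-h_*.$$ Let $\mathcal{M}\subset V^9$ be the set of solutions of the five equations $$\ell^2=1+2mh+2p^2m^2,\qquad Q_1^2+u_1^2=1,\qquad P_1^2-f_1(u_1)=0,\qquad Q_2^2+u_2^2=1,\qquad P_2^2-f_2(u_2)=0.$$ Then $\mathcal{M}$ is (non-empty and) connected, and it is a smooth 4-dimensional embedded submanifold of $V^9$. -/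

import Mathlib

open scoped Manifold ContDiff

noncomputable section

namespace SeparatedTop

/-- The space `V⁹` with coordinates, in this order, `(ℓ, m, h, u₁, Q₁, P₁, u₂, Q₂, P₂)`. -/
abbrev V9 : Type := EuclideanSpace ℝ (Fin 9)

/-- `p = √(a² + b²)`. -/
def p (a b : ℝ) : ℝ := Real.sqrt (a ^ 2 + b ^ 2)

/-- `h_* = -(h + p² m) / 2`. -/
def hStar (a b m h : ℝ) : ℝ := -(1 / 2) * (h + p a b ^ 2 * m)

/-- `f₁(u) = h_* u² + a ℓ u - a² m`. -/
def f₁ (a b l m h u : ℝ) : ℝ := hStar a b m h * u ^ 2 + a * l * u - a ^ 2 * m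

/-- `f₂(u) = b² m u² - b ℓ u - h_*`. -/
def f₂ (a b l m h u : ℝ) : ℝ := b ^ 2 * m * u ^ 2 - b * l * u - hStar a b m h

/-- The curve `Γ₁` in the space `ℝ³` of triples `(u₁, Q₁, P₁)`. -/
def Gamma₁ (a b l m h : ℝ) : Set (ℝ × ℝ × ℝ) :=
  {y | y.2.1 ^ 2 + y.1 ^ 2 = 1 ∧ y.2.2 ^ 2 - f₁ a b l m h y.1 = 0}

/-- The curve `Γ₂` in the space `ℝ³` of triples `(u₂, Q₂, P₂)`. -/
def Gamma₂ (a b l m h : ℝ) : Set (ℝ × ℝ × ℝ) :=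
  {y | y.2.1 ^ 2 + y.1 ^ 2 = 1 ∧ y.2.2 ^ 2 - f₂ a b l m h y.1 = 0}

/-- The set `𝓜 ⊆ V⁹` of all `(ℓ, m, h, u₁, Q₁, P₁, u₂, Q₂, P₂)` with
`ℓ² = 1 + 2 m h + 2 p² m²`, `(u₁, Q₁, P₁) ∈ Γ₁(ℓ, m, h)` and `(u₂, Q₂, P₂) ∈ Γ₂(ℓ, m, h)`. -/
def setM (a b : ℝ) : Set V9 :=
  {x | x 0 ^ 2 = 1 + 2 * x 1 * x 2 + 2 * p a b ^ 2 * x 1 ^ 2 ∧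
    (x 3, x 4, x 5) ∈ Gamma₁ a b (x 0) (x 1) (x 2) ∧
    (x 6, x 7, x 8) ∈ Gamma₂ a b (x 0) (x 1) (x 2)}

/-- `S` is an (embedded) smooth `k`-dimensional submanifold of the normed space `E`: the subspace
`S` carries a `k`-dimensional smooth manifold structure, without boundary and compatible with its
subspace topology, for which the inclusion into `E` is a smooth embedding. -/
def IsSmoothSubmanifold {E : Type*} [NormedAddCommGroup E] [NormedSpace ℝ E]
    (k : ℕ) (S : Set E) : Prop :=
  ∃ _ : ChartedSpace (EuclideanSpace ℝ (Fin k)) S,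
    IsManifold (𝓡 k) ∞ S ∧
      Manifold.IsSmoothEmbedding (𝓡 k) 𝓘(ℝ, E) ∞ (Subtype.val : S → E)

end SeparatedTop

end

-- Put k = h_*. The first equation becomes ℓ² + 4mk = 1: the binary form q(X, Y) = kX² + ℓXY − mY²
-- has discriminant 1. The others are two circles, P₁² = q(u₁, a) and P₂² = −q(1, bu₂).
--
-- Smoothness: by the regular level set theorem, the five gradients must be independent. The
-- right-hand sides for P₁², P₂² are linear in (ℓ, m, k) and the discriminant is quadratic, so
-- Euler's identity kills the first multiplier; a > b kills the rest (`multipliers_eq_zero`).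
--
-- Connectedness: since a > b, the vectors (u₁, a), (1, bu₂) form a basis with determinant −D, D = a
-- − bu₁u₂ > 0, and q is determined by its values P₁², −P₂² and its polar value β on it. The
-- discriminant condition becomes β² + 4P₁²P₂² = D², that is s² + x²y² = 1 with x = 2P₁/D, y = P₂, s
-- = β/D. Thus 𝓜 is a continuous image of a connected product (`param_mem`, `exists_param_eq`).

universe w

namespace SeparatedTop

open Set Module

/-! ### Level sets as embedded submanifolds -/

section Slice

variable {E F K : Type*} [NormedAddCommGroup E] [NormedAddCommGroup F] [NormedAddCommGroup K]

open Classical in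
/-- The chart of `S` induced by a local homeomorphism of the ambient space that flattens `S`. -/
noncomputable def sliceChart {S : Set E} (s₀ : S) (Φ : OpenPartialHomeomorph E (K × F))
    (hΦ : ∀ y ∈ Φ.source, y ∈ S ↔ (Φ y).2 = 0) : OpenPartialHomeomorph S K where
  toFun s := (Φ s).1
  invFun v := if h : (v, (0 : F)) ∈ Φ.target then
    ⟨Φ.symm (v, 0), (hΦ _ (Φ.map_target h)).2 (by rw [Φ.right_inv h])⟩ else s₀
  source := Subtype.val ⁻¹' Φ.source
  target := (fun v : K => (v, (0 : F))) ⁻¹' Φ.target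
  map_source' s hs := by
    have h0 : (Φ s).2 = 0 := (hΦ s hs).1 s.2
    have : ((Φ s).1, (0 : F)) = Φ s := by rw [← h0]
    simp only [mem_preimage, this]
    exact Φ.map_source hs
  map_target' v hv := by
    have hv' : (v, (0 : F)) ∈ Φ.target := hv
    simp only [mem_preimage, dif_pos hv']
    exact Φ.map_target hv'
  left_inv' s hs := by
    have h0 : (Φ s).2 = 0 := (hΦ s hs).1 s.2
    have h1 : ((Φ s).1, (0 : F)) = Φ s := by rw [← h0]
    have h2 : Φ s ∈ Φ.target := Φ.map_source hs
    apply Subtype.ext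
    simp only [h1, dif_pos h2]
    exact Φ.left_inv hs
  right_inv' v hv := by
    have hv' : (v, (0 : F)) ∈ Φ.target := hv
    simp only [dif_pos hv', Φ.right_inv hv']
  open_source := Φ.open_source.preimage continuous_subtype_val
  open_target := Φ.open_target.preimage (by fun_prop)
  continuousOn_toFun := continuous_fst.comp_continuousOn
    (Φ.continuousOn.comp continuous_subtype_val.continuousOn fun _ h => h)
  continuousOn_invFun := by
    rw [Topology.IsInducing.subtypeVal.continuousOn_iff]
    refine (Φ.continuousOn_symm.comp (f := fun v : K => (v, (0 : F)))
      (Continuous.continuousOn (by fun_prop)) fun _ h => h).congr ?_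
    intro v hv
    have hv' : (v, (0 : F)) ∈ Φ.target := hv
    simp [dif_pos hv']

variable {S : Set E} (s₀ : S) (Φ : OpenPartialHomeomorph E (K × F))
  (hΦ : ∀ y ∈ Φ.source, y ∈ S ↔ (Φ y).2 = 0)

theorem sliceChart_symm_apply {v : K} (hv : (v, (0 : F)) ∈ Φ.target) :
    ((sliceChart s₀ Φ hΦ).symm v : E) = Φ.symm (v, 0) := by
  classical
  change ((if h : (v, (0 : F)) ∈ Φ.target then ⟨Φ.symm (v, 0), _⟩ else s₀ : S) : E) = _
  rw [dif_pos hv]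

end Slice

variable {E F : Type w} [NormedAddCommGroup E] [NormedSpace ℝ E]
  [NormedAddCommGroup F] [NormedSpace ℝ F]

/-- A set that is flattened near each of its points by a smooth local diffeomorphism of the ambient
space onto an open subset of `ℝᵏ × F` is a smooth `k`-dimensional submanifold. -/
theorem isSmoothSubmanifold_of_slices {k : ℕ} (e : (EuclideanSpace ℝ (Fin k) × F) ≃L[ℝ] E)
    {S : Set E}
    (H : ∀ x ∈ S, ∃ Φ : OpenPartialHomeomorph E (EuclideanSpace ℝ (Fin k) × F), x ∈ Φ.source ∧
      ContDiffOn ℝ ∞ Φ Φ.source ∧ ContDiffOn ℝ ∞ Φ.symm Φ.target ∧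
      ∀ y ∈ Φ.source, y ∈ S ↔ (Φ y).2 = 0) :
    IsSmoothSubmanifold k S := by
  choose Φ hx hsm hsm' hfl using H
  let c : S → OpenPartialHomeomorph S (EuclideanSpace ℝ (Fin k)) :=
    fun s => sliceChart s (Φ s s.2) (hfl s s.2)
  let C : ChartedSpace (EuclideanSpace ℝ (Fin k)) S :=
    { atlas := range c
      chartAt := c
      mem_chart_source := fun s => hx s s.2
      chart_mem_atlas := fun s => mem_range_self s }
  have hM : IsManifold (𝓡 k) ∞ S := by
    apply isManifold_of_contDiffOn
    rintro _ _ ⟨s, rfl⟩ ⟨t, rfl⟩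
    have h1 : ContDiffOn ℝ ∞ (fun v : EuclideanSpace ℝ (Fin k) =>
        (Φ t t.2 ((Φ s s.2).symm (v, 0))).1) ((c s).symm ≫ₕ c t).source := by
      refine contDiff_fst.comp_contDiffOn ((hsm t t.2).comp ((hsm' s s.2).comp
        (f := fun v => (v, (0 : F))) (ContDiff.contDiffOn (by fun_prop)) ?_) ?_)
      · intro v hv
        exact hv.1
      · intro v hv
        have h2 := hv.2
        have h3 : (v, (0 : F)) ∈ (Φ s s.2).target := hv.1
        change ((c s).symm v : E) ∈ (Φ t t.2).source at h2
        rwa [sliceChart_symm_apply _ _ _ h3] at h2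
    refine (h1.congr ?_).mono (fun v hv => hv.1)
    intro v hv
    have h3 : (v, (0 : F)) ∈ (Φ s s.2).target := hv.1
    change (Φ t t.2 ((c s).symm v : E)).1 = _
    rw [sliceChart_symm_apply _ _ _ h3]
  refine ⟨C, hM, ⟨F, inferInstance, inferInstance, fun s => ?_⟩, Topology.IsEmbedding.subtypeVal⟩
  -- In these charts the inclusion reads v ↦ (v, 0), followed by `e`.
  refine Manifold.IsImmersionAtOfComplement.mk_of_charts e (c s)
    ((Φ s s.2).trans e.toHomeomorph.toOpenPartialHomeomorph) (hx s s.2) ?_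
    (IsManifold.subset_maximalAtlas (mem_range_self s)) ?_ ?_ ?_
  · simpa using hx s s.2
  · apply StructureGroupoid.mem_maximalAtlas_of_mem_groupoid
    rw [contDiffGroupoid, mem_groupoid_of_pregroupoid]
    constructor
    · exact (e.contDiff.comp_contDiffOn (hsm s s.2)).mono fun y hy => hy.1.1
    · exact ((hsm' s s.2).comp e.symm.contDiff.contDiffOn fun _ h => h).mono fun y hy => hy.1.2
  · intro t ht
    exact ⟨ht, mem_univ _⟩
  · intro v hv
    have h3 : (v, (0 : F)) ∈ (Φ s s.2).target := by
      rw [OpenPartialHomeomorph.extend_target] at hv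
      exact hv.1
    have h4 : ((c s).symm v : E) = _ := sliceChart_symm_apply _ _ _ h3
    simp [h4, (Φ s s.2).right_inv h3]

/-- A surjective linear map becomes the second component of an isomorphism onto a product. -/
theorem exists_equiv_prod_of_surjective [FiniteDimensional ℝ E] [FiniteDimensional ℝ F]
    {K : Type*} [NormedAddCommGroup K] [NormedSpace ℝ K] [FiniteDimensional ℝ K]
    (hdim : finrank ℝ E = finrank ℝ K + finrank ℝ F) (T : E →L[ℝ] F)
    (hT : Function.Surjective T) :
    ∃ (π : E →L[ℝ] K) (L : E ≃L[ℝ] K × F), (L : E →L[ℝ] K × F) = π.prod T := by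
  have hker : finrank ℝ T.toLinearMap.ker = finrank ℝ K := by
    have h1 := T.toLinearMap.finrank_range_add_finrank_ker
    rw [LinearMap.range_eq_top.2 hT, finrank_top] at h1
    omega
  obtain ⟨i⟩ := FiniteDimensional.nonempty_linearEquiv_of_finrank_eq hker
  -- A projection onto ker T separates the vectors that T does not.
  obtain ⟨r, hr⟩ := T.toLinearMap.ker.subtype.exists_leftInverse_of_injective
    (Submodule.ker_subtype _)
  let π : E →L[ℝ] K := (i.toLinearMap ∘ₗ r).toContinuousLinearMap
  have hinj : Function.Injective (π.prod T).toLinearMap := by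
    rw [← LinearMap.ker_eq_bot, LinearMap.ker_eq_bot']
    intro v hv
    have h1 : i (r v) = 0 := congrArg Prod.fst hv
    have h2 : T v = 0 := congrArg Prod.snd hv
    have h3 : r v = ⟨v, h2⟩ := LinearMap.congr_fun hr ⟨v, h2⟩
    rw [i.map_eq_zero_iff, h3] at h1
    exact congrArg Subtype.val h1
  let L := LinearEquiv.ofInjectiveOfFinrankEq (π.prod T).toLinearMap hinj
    (by rw [finrank_prod, hdim])
  exact ⟨π, L.toContinuousLinearEquiv, by ext v <;> rfl⟩

/-- Near a point with invertible derivative, a smooth map is a smooth local diffeomorphism. -/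
theorem exists_openPartialHomeomorph_contDiffOn {G : Type*} [NormedAddCommGroup G]
    [NormedSpace ℝ G] [CompleteSpace E] {f : E → G} (hf : ContDiff ℝ ∞ f) {x : E} {L : E ≃L[ℝ] G}
    (hL : HasFDerivAt f (L : E →L[ℝ] G) x) :
    ∃ Φ : OpenPartialHomeomorph E G, x ∈ Φ.source ∧ (Φ : E → G) = f ∧
      ContDiffOn ℝ ∞ Φ.symm Φ.target := by
  have hn : (∞ : WithTop ℕ∞) ≠ 0 := by simp
  -- The inverse is known to be smooth only where the derivative is invertible, an open condition,
  -- so the source is shrunk to `U`.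
  let U : Set E := fderiv ℝ f ⁻¹' range ((↑) : (E ≃L[ℝ] G) → E →L[ℝ] G)
  have hU : IsOpen U := (ContinuousLinearEquiv.isOpen (𝕜 := ℝ)).preimage (hf.continuous_fderiv hn)
  let Φ := (hf.contDiffAt (x := x)).toOpenPartialHomeomorph f hL hn
  refine ⟨Φ.restrOpen U hU, ⟨?_, ⟨L, hL.fderiv.symm⟩⟩, rfl, ?_⟩
  · exact (hf.contDiffAt (x := x)).mem_toOpenPartialHomeomorph_source hL hn
  · intro y hy
    obtain ⟨-, M, hM⟩ := (Φ.restrOpen U hU).map_target hy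
    refine ((Φ.restrOpen U hU).contDiffAt_symm (f₀' := M) hy ?_ hf.contDiffAt).contDiffWithinAt
    have h := (hf.differentiable hn).differentiableAt.hasFDerivAt
      (x := (Φ.restrOpen U hU).symm y)
    rwa [← hM] at h

/-- **Regular level set theorem** in Euclidean space. -/
theorem isSmoothSubmanifold_of_regular [FiniteDimensional ℝ E] [FiniteDimensional ℝ F] {k : ℕ}
    (hdim : finrank ℝ E = k + finrank ℝ F) {g : E → F} (hg : ContDiff ℝ ∞ g)
    (hreg : ∀ x, g x = 0 → Function.Surjective (fderiv ℝ g x)) :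
    IsSmoothSubmanifold k {x | g x = 0} := by
  have : CompleteSpace E := FiniteDimensional.complete ℝ E
  have hdim' : finrank ℝ E = finrank ℝ (EuclideanSpace ℝ (Fin k)) + finrank ℝ F := by
    rw [finrank_euclideanSpace_fin, hdim]
  refine isSmoothSubmanifold_of_slices (F := F)
    (ContinuousLinearEquiv.ofFinrankEq (by rw [finrank_prod, hdim'])) fun x hx => ?_
  obtain ⟨π, L, hL⟩ := exists_equiv_prod_of_surjective hdim' _ (hreg x hx)
  have hf : ContDiff ℝ ∞ fun y => (π y, g y) := π.contDiff.prodMk hg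
  obtain ⟨Φ, hxΦ, hΦ, hsymm⟩ := exists_openPartialHomeomorph_contDiffOn hf (x := x) (L := L) <| by
    rw [hL]
    exact π.hasFDerivAt.prodMk ((hg.differentiable (by simp)).differentiableAt.hasFDerivAt)
  refine ⟨Φ, hxΦ, by rw [hΦ]; exact hf.contDiffOn, hsymm, fun y _ => ?_⟩
  rw [hΦ]
  rfl

/-! ### The five equations and their gradients -/

/-- The five defining functions of `setM`. -/
noncomputable def defining (a b : ℝ) (x : V9) : Fin 5 → ℝ :=
  ![x 0 ^ 2 - (1 + 2 * x 1 * x 2 + 2 * p a b ^ 2 * x 1 ^ 2),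
    x 4 ^ 2 + x 3 ^ 2 - 1,
    x 5 ^ 2 - f₁ a b (x 0) (x 1) (x 2) (x 3),
    x 7 ^ 2 + x 6 ^ 2 - 1,
    x 8 ^ 2 - f₂ a b (x 0) (x 1) (x 2) (x 6)]

theorem setM_eq_defining_eq_zero (a b : ℝ) : setM a b = {x | defining a b x = 0} := by
  ext x
  simp only [setM, Gamma₁, Gamma₂, defining, mem_ofPred_eq, funext_iff, Fin.forall_fin_succ,
    Matrix.cons_val_zero, Matrix.cons_val_succ, Pi.zero_apply,
    sub_eq_zero, IsEmpty.forall_iff, and_true, and_assoc]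

theorem contDiff_defining (a b : ℝ) : ContDiff ℝ ∞ (defining a b) := by
  rw [contDiff_pi]
  intro i
  fin_cases i <;> simp only [defining, f₁, f₂, hStar] <;> simp <;> fun_prop

/-- The differential of `defining a b` at `x` in the direction `v`. -/
noncomputable def definingDeriv (a b : ℝ) (x v : V9) : Fin 5 → ℝ :=
  ![2 * x 0 * v 0 - 2 * x 1 * v 2 - 2 * x 2 * v 1 - 4 * p a b ^ 2 * x 1 * v 1,
    2 * x 4 * v 4 + 2 * x 3 * v 3,
    2 * x 5 * v 5 - (hStar a b (v 1) (v 2) * x 3 ^ 2 + 2 * hStar a b (x 1) (x 2) * x 3 * v 3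
      + a * v 0 * x 3 + a * x 0 * v 3 - a ^ 2 * v 1),
    2 * x 7 * v 7 + 2 * x 6 * v 6,
    2 * x 8 * v 8 - (b ^ 2 * v 1 * x 6 ^ 2 + 2 * b ^ 2 * x 1 * x 6 * v 6
      - b * v 0 * x 6 - b * x 0 * v 6 - hStar a b (v 1) (v 2))]

theorem hasDerivAt_defining_line (a b : ℝ) (x v : V9) :
    HasDerivAt (fun t : ℝ => defining a b (x + t • v)) (definingDeriv a b x v) 0 := by
  have d : ∀ j, HasDerivAt (fun t : ℝ => x j + t * v j) (v j) 0 := fun j => by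
    simpa using ((hasDerivAt_id (0 : ℝ)).mul_const (v j)).const_add (x j)
  rw [hasDerivAt_pi]
  intro i
  fin_cases i <;> simp only [defining, definingDeriv, f₁, f₂, hStar] <;> simp
  · convert ((d 0).fun_pow 2).fun_sub (((((d 1).const_mul 2).fun_mul (d 2)).const_add 1).fun_add
      (((d 1).fun_pow 2).const_mul (2 * p a b ^ 2))) using 1
    simp
    ring
  · convert ((d 4).fun_pow 2).fun_add ((d 3).fun_pow 2) using 1
    simp
  · convert ((d 5).fun_pow 2).fun_sub ((((((d 2).fun_add ((d 1).const_mul (p a b ^ 2))).const_mul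
      (-2⁻¹)).fun_mul ((d 3).fun_pow 2)).fun_add (((d 0).const_mul a).fun_mul (d 3))).fun_sub
      ((d 1).const_mul (a ^ 2))) using 1
    · simp
    · simp
      ring
  · convert ((d 7).fun_pow 2).fun_add ((d 6).fun_pow 2) using 1
    simp
  · convert ((d 8).fun_pow 2).fun_sub (((((d 1).const_mul (b ^ 2)).fun_mul
      ((d 6).fun_pow 2)).fun_sub (((d 0).const_mul b).fun_mul (d 6))).fun_sub
      (((d 2).fun_add ((d 1).const_mul (p a b ^ 2))).const_mul (-2⁻¹))) using 1
    · simp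
    · simp
      ring

theorem fderiv_defining_apply (a b : ℝ) (x v : V9) :
    fderiv ℝ (defining a b) x v = definingDeriv a b x v := by
  have h : HasFDerivAt (defining a b) (fderiv ℝ (defining a b) x) (x + (0 : ℝ) • v) := by
    rw [zero_smul, add_zero]
    exact ((contDiff_defining a b).differentiable (by simp)).differentiableAt.hasFDerivAt
  have h1 : HasDerivAt (fun t : ℝ => x + t • v) v 0 := by
    simpa using ((hasDerivAt_id (0 : ℝ)).smul_const v).const_add x
  have h2 : HasDerivAt (fun t : ℝ => defining a b (x + t • v)) (fderiv ℝ (defining a b) x v) 0 :=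
    HasFDerivAt.comp_hasDerivAt (f := fun t : ℝ => x + t • v) 0 h h1
  exact h2.unique (hasDerivAt_defining_line a b x v)

/-- The gradients of the five defining functions are linearly independent, in coordinates. -/
theorem multipliers_eq_zero {a b l m k u Q P v R S : ℝ} (hb : 0 < b) (hab : b < a)
    (h0 : l ^ 2 + 4 * m * k = 1) (hQ : Q ^ 2 + u ^ 2 = 1)
    (hP : P ^ 2 = k * u ^ 2 + a * l * u - a ^ 2 * m) (hR : R ^ 2 + v ^ 2 = 1)
    (hS : S ^ 2 = b ^ 2 * m * v ^ 2 - b * l * v - k) {c₀ c₁ c₂ c₃ c₄ : ℝ}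
    (el : 2 * c₀ * l - c₂ * a * u + c₄ * b * v = 0)
    (em : 4 * c₀ * k + c₂ * a ^ 2 - c₄ * b ^ 2 * v ^ 2 = 0)
    (ek : 4 * c₀ * m - c₂ * u ^ 2 + c₄ = 0)
    (eQ : c₁ * Q = 0) (eP : c₂ * P = 0) (eu : 2 * c₁ * u = c₂ * (2 * k * u + a * l))
    (eR : c₃ * R = 0) (eS : c₄ * S = 0) (ev : 2 * c₃ * v = c₄ * (2 * b ^ 2 * m * v - b * l)) :
    c₀ = 0 ∧ c₁ = 0 ∧ c₂ = 0 ∧ c₃ = 0 ∧ c₄ = 0 := by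
  -- Euler's identity: pairing (`el`, `em`, `ek`) with (l, m, k) gives 2c₀ − c₂P² − c₄S² = 0, and
  -- c₂P = c₄S = 0.
  have k0 : c₀ = 0 := by
    linear_combination (-c₀) * h0 + (l * el + m * em + k * ek) / 2 + (P * eP + S * eS) / 2
      - c₂ / 2 * hP - c₄ / 2 * hS
  subst k0
  have e4 : c₄ = c₂ * u ^ 2 := by linear_combination ek
  have hu : u ^ 2 ≤ 1 := by nlinarith
  have hv : v ^ 2 ≤ 1 := by nlinarith
  have huv : u ^ 2 * v ^ 2 ≤ 1 := mul_le_one₀ hu (sq_nonneg v) hv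
  have hpos : 0 < a ^ 2 - b ^ 2 * (u ^ 2 * v ^ 2) := by nlinarith [sq_nonneg b]
  have k2 : c₂ = 0 := by
    have : c₂ * (a ^ 2 - b ^ 2 * (u ^ 2 * v ^ 2)) = 0 := by
      linear_combination em + b ^ 2 * v ^ 2 * e4
    exact (mul_eq_zero.1 this).resolve_right hpos.ne'
  have k4 : c₄ = 0 := by rw [e4, k2, zero_mul]
  subst k2 k4
  exact ⟨rfl, by linear_combination (-c₁) * hQ + Q * eQ + u / 2 * eu, rfl,
    by linear_combination (-c₃) * hR + R * eR + v / 2 * ev, rfl⟩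

theorem fderiv_defining_surjective {a b : ℝ} (hb : 0 < b) (hab : b < a) {x : V9}
    (hx : defining a b x = 0) : Function.Surjective (fderiv ℝ (defining a b) x) := by
  change Function.Surjective (fderiv ℝ (defining a b) x).toLinearMap
  -- A functional vanishing on the range is a vector of Lagrange multipliers.
  rw [← LinearMap.dualMap_injective_iff, ← LinearMap.ker_eq_bot, LinearMap.ker_eq_bot']
  intro φ hφ
  set c : Fin 5 → ℝ := fun i => φ fun j => if i = j then 1 else 0 with hc
  have hsum : ∀ w : Fin 5 → ℝ, φ w = ∑ i, w i * c i := fun w => φ.pi_apply_eq_sum_univ w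
  have key : ∀ v : V9, ∑ i, definingDeriv a b x v i * c i = 0 := fun v => by
    rw [← hsum, ← fderiv_defining_apply]
    exact LinearMap.congr_fun hφ v
  have e := fun j => key (EuclideanSpace.single j 1)
  have z := fun i => congrFun hx i
  simp [Fin.forall_fin_succ, Fin.sum_univ_succ, defining, definingDeriv, f₁, f₂, hStar] at e z
  obtain ⟨z0, z1, z2, z3, z4⟩ := z
  obtain ⟨e0, e1, e2, e3, e4, e5, e6, e7, e8⟩ := e
  obtain ⟨c0, c1, c2, c3, c4⟩ := multipliers_eq_zero (l := x 0) (m := x 1)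
    (k := hStar a b (x 1) (x 2)) (u := x 3) (Q := x 4) (P := x 5) (v := x 6) (R := x 7) (S := x 8)
    (c₀ := c 0) (c₁ := c 1) (c₂ := c 2) (c₃ := c 3) (c₄ := c 4) hb hab
    (by rw [hStar]; linear_combination z0) (by linear_combination z1)
    (by rw [hStar]; linear_combination z2) (by linear_combination z3)
    (by rw [hStar]; linear_combination z4) (by linear_combination e0)
    -- Since h = −2k − p²m, passing to coordinates (m, k) gives ∂ₘ − p²∂ₕ and −2∂ₕ.
    (by rw [hStar]; linear_combination e1 - p a b ^ 2 * e2) (by linear_combination (-2) * e2)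
    (mul_eq_zero.2 e4.symm) (mul_eq_zero.2 e5.symm) (by rw [hStar]; linear_combination e3)
    (mul_eq_zero.2 e7.symm) (mul_eq_zero.2 e8.symm) (by linear_combination e6)
  apply LinearMap.ext
  intro w
  rw [hsum]
  simp [Fin.sum_univ_succ, c0, c1, c2, c3, c4]

/-! ### Connectedness -/

theorem exists_cos_sin_of_sq_add_sq {c s : ℝ} (h : c ^ 2 + s ^ 2 = 1) :
    ∃ t : ℝ, Real.cos t = c ∧ Real.sin t = s := by
  have hn : ‖(⟨c, s⟩ : ℂ)‖ = 1 := by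
    rw [Complex.norm_def, Complex.normSq_mk, Real.sqrt_eq_one]
    linarith
  refine ⟨Complex.arg ⟨c, s⟩, ?_, ?_⟩
  · simpa [hn] using Complex.norm_mul_cos_arg ⟨c, s⟩
  · simpa [hn] using Complex.norm_mul_sin_arg ⟨c, s⟩

/-- The surface `s² + x² y² = 1` in the space of triples `(x, y, s)`. -/
def crossSurface : Set (ℝ × ℝ × ℝ) := {w | w.2.2 ^ 2 + w.1 ^ 2 * w.2.1 ^ 2 = 1}

theorem isPathConnected_crossSurface : IsPathConnected crossSurface := by
  have hx : ∀ x y s : ℝ, x ≠ 0 → (x, y, s) ∈ crossSurface →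
      JoinedIn crossSurface (x, y, s) (0, 0, 1) := by
    intro x y s hx h
    obtain ⟨t, rfl, ht⟩ := exists_cos_sin_of_sq_add_sq (c := s) (s := x * y)
      (by rw [mul_pow]; exact h)
    -- With x ≠ 0 fixed, (s, xy) lies on the unit circle and rotates to (1, 0).
    have h1 : JoinedIn crossSurface (x, y, Real.cos t) (x, 0, 1) := by
      refine JoinedIn.ofLine (f := fun r => (x, Real.sin ((1 - r) * t) / x, Real.cos ((1 - r) * t)))
        (Continuous.continuousOn (by fun_prop)) ?_ ?_ ?_
      · simp [ht, hx]
      · simp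
      · rintro _ ⟨r, -, rfl⟩
        change Real.cos _ ^ 2 + x ^ 2 * (Real.sin _ / x) ^ 2 = 1
        rw [div_pow, mul_div_cancel₀ _ (pow_ne_zero 2 hx), Real.cos_sq_add_sin_sq]
    refine h1.trans (JoinedIn.ofLine (f := fun r => ((1 - r) * x, 0, 1))
        (Continuous.continuousOn (by fun_prop)) ?_ ?_ ?_)
    · simp
    · simp
    · rintro _ ⟨r, -, rfl⟩
      simp [crossSurface]
  refine ⟨(0, 0, 1), by simp [crossSurface], ?_⟩
  rintro ⟨x, y, s⟩ h
  refine JoinedIn.symm ?_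
  by_cases hx0 : x = 0
  · subst hx0
    have hs : s ^ 2 = 1 := by simpa [crossSurface] using h
    have h1 : JoinedIn crossSurface (0, y, s) (0, 0, s) := by
      refine JoinedIn.ofLine (f := fun r => (0, (1 - r) * y, s))
        (Continuous.continuousOn (by fun_prop)) (by simp) (by simp) ?_
      rintro _ ⟨r, -, rfl⟩
      -- On x = 0 or y = 0 only s² = 1 is required, so one can slide along the axes to a point with
      -- x ≠ 0.
      simp [crossSurface, hs]
    have h2 : JoinedIn crossSurface (0, 0, s) (1, 0, s) := by
      refine JoinedIn.ofLine (f := fun r => (r, 0, s))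
        (Continuous.continuousOn (by fun_prop)) (by simp) (by simp) ?_
      rintro _ ⟨r, -, rfl⟩
      simp [crossSurface, hs]
    exact (h1.trans h2).trans (hx 1 0 s one_ne_zero h2.target_mem)
  · exact hx x y s hx0 h

/-- The parametrization of `setM a b` by the product of two circles, given by angles, and
`crossSurface`. With the binary quadratic form `q(X, Y) = h_* X² + ℓ X Y - m Y²`, of discriminant
`1`, the equations of the curves are `P₁² = q(u₁, a)` and `P₂² = -q(1, b u₂)`; the form is
recovered from these two values and from the value of its polar form, `s (a - b u₁ u₂)`. -/
noncomputable def param (a b : ℝ) (w : ℝ × ℝ × ℝ × ℝ × ℝ) : V9 :=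
  let u := Real.sin w.1
  let v := Real.sin w.2.1
  let x := w.2.2.1
  let y := w.2.2.2.1
  let s := w.2.2.2.2
  let D := a - b * u * v
  let m := -(x ^ 2 / 4 - u * s / D - u ^ 2 * y ^ 2 / D ^ 2)
  let k := b ^ 2 * v ^ 2 * x ^ 2 / 4 - a * b * v * s / D - a ^ 2 * y ^ 2 / D ^ 2
  let l := (a + b * u * v) * s / D + 2 * a * u * y ^ 2 / D ^ 2 - b * v * x ^ 2 / 2
  !₂[l, m, -2 * k - p a b ^ 2 * m, u, Real.cos w.1, x * D / 2, v, Real.cos w.2.1, y]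

/-- This is the only use of a > b > 0 for connectedness: it makes (u, a), (1, bv) a basis. -/
theorem sub_mul_pos {a b u v : ℝ} (hb : 0 < b) (hab : b < a) (hu : |u| ≤ 1) (hv : |v| ≤ 1) :
    0 < a - b * u * v := by
  have h1 : |u * v| ≤ 1 := by
    rw [abs_mul]
    exact mul_le_one₀ hu (abs_nonneg v) hv
  nlinarith [(abs_le.1 h1).2]

theorem continuous_param {a b : ℝ} (hb : 0 < b) (hab : b < a) : Continuous (param a b) := by
  have hD : ∀ w : ℝ × ℝ × ℝ × ℝ × ℝ, a - b * Real.sin w.1 * Real.sin w.2.1 ≠ 0 := fun w =>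
    (sub_mul_pos hb hab (Real.abs_sin_le_one _) (Real.abs_sin_le_one _)).ne'
  have hD2 : ∀ w : ℝ × ℝ × ℝ × ℝ × ℝ, (a - b * Real.sin w.1 * Real.sin w.2.1) ^ 2 ≠ 0 :=
    fun w => pow_ne_zero 2 (hD w)
  refine (PiLp.continuous_toLp 2 _).comp (continuous_pi fun i => ?_)
  fin_cases i <;> simp <;> fun_prop (disch := assumption)

theorem param_mem {a b : ℝ} (hb : 0 < b) (hab : b < a) {w : ℝ × ℝ × ℝ × ℝ × ℝ}
    (hw : w.2.2 ∈ crossSurface) : param a b w ∈ setM a b := by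
  obtain ⟨t, r, x, y, s⟩ := w
  have hD := (sub_mul_pos hb hab (Real.abs_sin_le_one t) (Real.abs_sin_le_one r)).ne'
  have hw' : s ^ 2 + x ^ 2 * y ^ 2 = 1 := hw
  obtain ⟨D, hDef⟩ : ∃ D, a - b * Real.sin t * Real.sin r = D := ⟨_, rfl⟩
  -- Eliminating `a` leaves `D` as an atomic denominator.
  have ha : a = D + b * Real.sin t * Real.sin r := by linear_combination hDef
  rw [hDef] at hD
  refine ⟨?_, ⟨?_, ?_⟩, ?_, ?_⟩
  · simp [param, hDef]
    generalize p a b ^ 2 = c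
    generalize Real.sin t = u at *
    generalize Real.sin r = v at *
    subst ha
    field_simp
    linear_combination D ^ 4 * 64 * hw'
  · simp [param]
  · simp [param, f₁, hStar, hDef]
    generalize p a b ^ 2 = c
    generalize Real.sin t = u at *
    generalize Real.sin r = v at *
    subst ha
    field_simp
    ring
  · simp [param]
  · simp [param, f₂, hStar, hDef]
    generalize p a b ^ 2 = c
    generalize Real.sin t = u at *
    generalize Real.sin r = v at *
    subst ha
    field_simp
    ring

theorem exists_param_eq {a b : ℝ} (hb : 0 < b) (hab : b < a) {z : V9} (hz : z ∈ setM a b) :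
    ∃ w, w.2.2 ∈ crossSurface ∧ param a b w = z := by
  obtain ⟨h0, ⟨hQ, hP⟩, hR, hS⟩ := hz
  dsimp only at hQ hP hR hS
  obtain ⟨t, ht, ht'⟩ := exists_cos_sin_of_sq_add_sq hQ
  obtain ⟨r, hr, hr'⟩ := exists_cos_sin_of_sq_add_sq hR
  have hD := (sub_mul_pos hb hab (Real.abs_sin_le_one t) (Real.abs_sin_le_one r)).ne'
  rw [ht', hr'] at hD
  obtain ⟨D, hDef⟩ : ∃ D, a - b * z 3 * z 6 = D := ⟨_, rfl⟩
  obtain ⟨k, hk⟩ : ∃ k, hStar a b (z 1) (z 2) = k := ⟨_, rfl⟩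
  rw [hDef] at hD
  rw [f₁, hk] at hP
  rw [f₂, hk] at hS
  have hz2 : z 2 = -2 * k - p a b ^ 2 * z 1 := by rw [← hk, hStar]; ring
  have h0' : z 0 ^ 2 + 4 * z 1 * k = 1 := by rw [h0, hz2]; ring
  -- The polar form of q at (u₁, a), (1, bu₂). The next three facts recover q from D·(0, 1) = (u₁,
  -- a) − u₁(1, bu₂) and D·(1, 0) = a(1, bu₂) − bu₂(u₁, a).
  obtain ⟨β, hβ⟩ : ∃ β, β = 2 * k * z 3 + z 0 * (z 3 * b * z 6 + a) - 2 * z 1 * a * b * z 6 :=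
    ⟨_, rfl⟩
  have hm : z 3 ^ 2 * z 8 ^ 2 / D ^ 2 - ((2 * z 5 / D) ^ 2 / 4 - z 3 * (β / D) / D) = z 1 := by
    have h : z 3 ^ 2 * z 8 ^ 2 - z 5 ^ 2 + z 3 * β = z 1 * D ^ 2 := by
      rw [hβ, ← hDef]
      linear_combination z 3 ^ 2 * hS - hP
    field_simp
    linear_combination 4 * h
  have hl : (a + b * z 3 * z 6) * (β / D) / D + 2 * a * z 3 * z 8 ^ 2 / D ^ 2
      - b * z 6 * (2 * z 5 / D) ^ 2 / 2 = z 0 := by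
    have h : (a + b * z 3 * z 6) * β + 2 * a * z 3 * z 8 ^ 2 - 2 * b * z 6 * z 5 ^ 2
        = z 0 * D ^ 2 := by
      rw [hβ, ← hDef]
      linear_combination 2 * a * z 3 * hS - 2 * b * z 6 * hP
    field_simp
    linear_combination h
  have hk' : b ^ 2 * z 6 ^ 2 * (2 * z 5 / D) ^ 2 / 4 - a * b * z 6 * (β / D) / D
      - a ^ 2 * z 8 ^ 2 / D ^ 2 = k := by
    have h : b ^ 2 * z 6 ^ 2 * z 5 ^ 2 - a * b * z 6 * β - a ^ 2 * z 8 ^ 2 = k * D ^ 2 := by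
      rw [hβ, ← hDef]
      linear_combination b ^ 2 * z 6 ^ 2 * hP - a ^ 2 * hS
    field_simp
    linear_combination 4 * h
  refine ⟨(t, r, 2 * z 5 / D, z 8, β / D), ?_, ?_⟩
  · change (β / D) ^ 2 + (2 * z 5 / D) ^ 2 * z 8 ^ 2 = 1
    -- A change of basis multiplies the discriminant by the squared determinant.
    have h : β ^ 2 + 4 * z 5 ^ 2 * z 8 ^ 2 = D ^ 2 := by
      rw [hβ, ← hDef]
      linear_combination 4 * z 8 ^ 2 * hP
        + 4 * (k * z 3 ^ 2 + a * z 0 * z 3 - a ^ 2 * z 1) * hS + (a - b * z 3 * z 6) ^ 2 * h0'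
    field_simp
    linear_combination h
  · ext i
    fin_cases i <;> simp [param, ht, ht', hr, hr', hDef]
    · exact hl
    · exact hm
    · rw [hm, hk', hz2]
      ring
    · field_simp

theorem isConnected_setM {a b : ℝ} (hb : 0 < b) (hab : b < a) : IsConnected (setM a b) := by
  have h : setM a b = param a b '' (univ ×ˢ univ ×ˢ crossSurface) := by
    ext z
    constructor
    · intro hz
      obtain ⟨w, hw, rfl⟩ := exists_param_eq hb hab hz
      exact ⟨w, ⟨mem_univ _, mem_univ _, hw⟩, rfl⟩
    · rintro ⟨w, ⟨-, -, hw⟩, rfl⟩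
      exact param_mem hb hab hw
  rw [h]
  exact (isConnected_univ.prod (isConnected_univ.prod
    isPathConnected_crossSurface.isConnected)).image _ (continuous_param hb hab).continuousOn

end SeparatedTop

theorem lemma1 (a b : ℝ) (hb : 0 < b) (hab : b < a) :
    IsConnected (SeparatedTop.setM a b) ∧
      SeparatedTop.IsSmoothSubmanifold 4 (SeparatedTop.setM a b) := by
  refine ⟨SeparatedTop.isConnected_setM hb hab, ?_⟩
  rw [SeparatedTop.setM_eq_defining_eq_zero]
  exact SeparatedTop.isSmoothSubmanifold_of_regular (by simp)
    (SeparatedTop.contDiff_defining a b) fun _ hx => SeparatedTop.fderiv_defining_surjective hb hab hx
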